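/- Let $\mathbb I=[-1,1]$ and let $\|\cdot\|_2$ be the norm of the real space $L_2=L_2(\mathbb I)$. For $m\in\mathbb N$, let $L_2^m$ be the space of functions $f:\mathbb I\to\mathbb R$ whose derivative $f^{(m-1)}$ is absolutely continuous on $\mathbb I$ and for which $f^{(m)}\in L_2$ (derivatives at $\pm1$ are one-sided). Let $r\in\mathbb N$ and let $k$ be an integer with $0\le k\le r-1$. Put $$W_2^r=\{f\in L_2^r:\ \|f^{(r)}\|_2\le 1\}.$$ For $\delta>0$ define $$\Omega_{-1}(\delta)=\sup\{|f^{(k)}(-1)|:\ f\in W_2^r,\ \|f\|_2\le\delta\},$$ and, for a set $\mathscr R$ of mappings $S:L_2\to\mathbb R$, $$\mathcal E_\delta(\mathscr R)=\inf_{S\in\mathscr R}\ \sup\{|f^{(k)}(-1)-S y|:\ f\in W_2^r,\ y\in L_2,\ \|f-y\|_2\le\delta\}.$$ Let $\mathscr O$ be the set of all mappings $L_2\to\mathbb R$ and $\mathscr L$ the set of all linear mappings $L_2\to\mathbb R$. **Theorem.** For every $\lambda\ge 0$ the boundary value problem $$(-1)^r u^{(2r)}(x)+\lambda u(x)=0,\quad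 x\in(-1,1),$$ $$u^{(s)}(-1)=(-1)^{k-1}\delta_{r-k-1,s},\qquad u^{(s)}(1)=0,\qquad s=0,1,\dots,r-1,$$ where $\delta_{i,j}$ is the Kronecker symbol, has a unique solution $u_\lambda\in L_2^{2r}$. For every $\delta>0$ there is a unique $\lambda>0$ such that $$\delta\lambda\,\|u_\lambda\|_2=\|u_\lambda^{(r)}\|_2,$$ and, for this $\lambda$, $$\Omega_{-1}(\delta)=\mathcal E_\delta(\mathscr O)=\mathcal E_\delta(\mathscr L)=\|u_\lambda^{(r)}\|_2\,\delta+\|u_\lambda\|_2 .$$ -/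

import Mathlib

open MeasureTheory Set
open scoped ENNReal

namespace LandauKolmogorov

/-- The interval `[-1, 1]`. -/
def I : Set ℝ := Icc (-1) 1

/-- Lebesgue measure on `[-1, 1]`. -/
noncomputable def μI : Measure ℝ := volume.restrict I

/-- The real Banach space `L₂[-1, 1]`. -/
abbrev L2 : Type := Lp ℝ 2 μI

/-- The `j`-th derivative of a function on `[-1, 1]` (one-sided at the end points). It depends
only on the values of `f` on `[-1, 1]`. -/
noncomputable def D (j : ℕ) (f : ℝ → ℝ) : ℝ → ℝ := iteratedDerivWithin j f I

/-- The norm of `L₂[-1, 1]`; it is only applied to square integrable functions below. -/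
noncomputable def norm2 (g : ℝ → ℝ) : ℝ := (eLpNorm g 2 μI).toReal

/-- `L₂^r` for `r ≥ 1`: the functions on `[-1, 1]` with absolutely continuous `(r-1)`-th derivative
whose `r`-th derivative, which then exists almost everywhere, belongs to `L₂`. Functions on
`[-1, 1]` are represented by functions on `ℝ` whose values outside `[-1, 1]` play no role. -/
structure MemL2r (r : ℕ) (f : ℝ → ℝ) : Prop where
  contDiffOn : ContDiffOn ℝ (r - 1 : ℕ) f I
  absCont : AbsolutelyContinuousOnInterval (D (r - 1) f) (-1) 1
  memLp : MemLp (D r f) 2 μI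

/-- The class `W₂^r = {f ∈ L₂^r : ‖f^{(r)}‖₂ ≤ 1}`. -/
def W (r : ℕ) : Set (ℝ → ℝ) := {f | MemL2r r f ∧ norm2 (D r f) ≤ 1}

/-- `Ω_t(δ) = sup {|f^{(k)}(t)| : f ∈ W₂^r, ‖f‖₂ ≤ δ}`, with values in `[0, ∞]`. -/
noncomputable def modulus (r k : ℕ) (t δ : ℝ) : ℝ≥0∞ :=
  ⨆ (f : ℝ → ℝ) (_ : f ∈ W r) (_ : norm2 f ≤ δ), ENNReal.ofReal |D k f t|

/-- The error of a recovery method `S : L₂ → ℝ`,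
`U_δ(S) = sup {|f^{(k)}(t) - S y| : f ∈ W₂^r, y ∈ L₂, ‖f - y‖₂ ≤ δ}`, with values in `[0, ∞]`. -/
noncomputable def methodError (r k : ℕ) (t δ : ℝ) (S : L2 → ℝ) : ℝ≥0∞ :=
  ⨆ (f : ℝ → ℝ) (_ : f ∈ W r) (y : L2) (_ : norm2 (fun x => f x - y x) ≤ δ),
    ENNReal.ofReal |D k f t - S y|

/-- The error of optimal recovery of `f ↦ f^{(k)}(t)` on `W₂^r` by methods from the set `R`. -/
noncomputable def optimalError (R : Set (L2 → ℝ)) (r k : ℕ) (t δ : ℝ) : ℝ≥0∞ :=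
  ⨅ (S : L2 → ℝ) (_ : S ∈ R), methodError r k t δ S

/-- All mappings `L₂ → ℝ`. -/
def allMethods : Set (L2 → ℝ) := univ

/-- All linear mappings `L₂ → ℝ`. -/
def linearMethods : Set (L2 → ℝ) := {S | IsLinearMap ℝ S}

/-- `u ∈ L₂^{2r}` solves `(-1)^r u^{(2r)} + lam u = 0` on `(-1, 1)` with
`u^{(s)}(-1) = (-1)^{k-1} δ_{r-k-1,s}` and `u^{(s)}(1) = 0` for `0 ≤ s ≤ r-1`.
The sign `(-1)^{k-1}` is written as `(-1)^(k+1)`; the index `r - k - 1` is used for `k < r`. -/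
structure IsSolution (r k : ℕ) (lam : ℝ) (u : ℝ → ℝ) : Prop where
  memL2r : MemL2r (2 * r) u
  eqn : ∀ x ∈ Ioo (-1 : ℝ) 1, (-1 : ℝ) ^ r * D (2 * r) u x + lam * u x = 0
  left : ∀ s < r, D s u (-1) = if s = r - k - 1 then (-1 : ℝ) ^ (k + 1) else 0
  right : ∀ s < r, D s u 1 = 0

end LandauKolmogorov

/-! Integrating by parts `r` times against the solution `u` leaves a single boundary term, so
`f^{(k)}(-1) = ⟨u^{(r)}, f⟩ - (-1)^r ⟨u, f^{(r)}⟩` for every `f` in `L₂^r` (`IsSolution.D_neg_one`).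
By Cauchy–Schwarz the linear method `y ↦ ⟨u^{(r)}, y⟩` has error at most `‖u^{(r)}‖ δ + ‖u‖`, for
any parameter. No method beats the modulus, since `f` and `-f` are both compatible with the data `y
= 0`. Conversely, a multiple of `u^{(r)}` makes both Cauchy–Schwarz estimates equalities, because
its `r`-th derivative is a multiple of `u`; it meets both norm constraints exactly when `δλ‖u‖ =
‖u^{(r)}‖`.

The boundary value problem is solved by a dimension count: an energy identity gives uniqueness,
hence surjectivity of the map from initial data to boundary data.

The parameter `λ` is found in an abstract Hilbert space setting. Applying the identity to `f =
u_m^{(r)}` gives `EnergyRelation`. It yields continuity in the parameter and, via equality in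
Cauchy–Schwarz, uniqueness of `λ`. Existence is the intermediate value theorem; a sign change must
occur, for otherwise the energies stay bounded along `λ = 2^n`, which exponential test functions
exclude. -/

namespace LandauKolmogorov

/-! ### Existence and uniqueness of the parameter, from the energy relation -/

section Abstract

open Filter Topology

variable {H : Type*} [NormedAddCommGroup H] [InnerProductSpace ℝ H]

/-- `V l` and `U l` stand for the `r`-th derivative and the values of the solution with
parameter `l`; the relation expresses that the energies `‖V‖² + m ‖U‖²` are stationary. -/
def EnergyRelation (U V : ℝ → H) : Prop :=
  ∀ l m : ℝ, 0 ≤ l → 0 ≤ m →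
    inner ℝ (V l) (V m) + m * inner ℝ (U l) (U m) = ‖V m‖ ^ 2 + m * ‖U m‖ ^ 2

namespace EnergyRelation

variable {U V : ℝ → H}

lemma energy_le (h : EnergyRelation U V) {l m : ℝ} (hl : 0 ≤ l) (hm : 0 ≤ m) :
    ‖V m‖ ^ 2 + m * ‖U m‖ ^ 2 ≤ ‖V l‖ ^ 2 + m * ‖U l‖ ^ 2 := by
  have h1 := h l m hl hm
  have h2 := norm_sub_sq_real (V l) (V m)
  have h3 := norm_sub_sq_real (U l) (U m)
  have h4 : 0 ≤ m * ‖U l - U m‖ ^ 2 := by positivity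
  rw [h3] at h4
  nlinarith [sq_nonneg ‖V l - V m‖]

/-- Adding the relations for `(l, m)` and `(m, l)` cancels everything except `(m - l) ⟨U m, U l - U
m⟩`. -/
lemma diff_energy (h : EnergyRelation U V) {l m : ℝ} (hl : 0 ≤ l) (hm : 0 ≤ m) :
    ‖V l - V m‖ ^ 2 + l * ‖U l - U m‖ ^ 2 ≤ |l - m| * ‖U m‖ * ‖U l - U m‖ := by
  have h1 := h l m hl hm
  have h1' := h m l hm hl
  rw [real_inner_comm, real_inner_comm (U l)] at h1'
  have h2 := norm_sub_sq_real (V l) (V m)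
  have h3 := norm_sub_sq_real (U l) (U m)
  have h4 : inner ℝ (U m) (U l - U m) = inner ℝ (U l) (U m) - ‖U m‖ ^ 2 := by
    rw [inner_sub_right, real_inner_self_eq_norm_sq, real_inner_comm]
  have h5 : ‖V l - V m‖ ^ 2 + l * ‖U l - U m‖ ^ 2 = (m - l) * inner ℝ (U m) (U l - U m) := by
    rw [h2, h3, h4]; linear_combination -h1 - h1'
  rw [h5]
  calc _ ≤ |(m - l) * inner ℝ (U m) (U l - U m)| := le_abs_self _
    _ = |l - m| * |inner ℝ (U m) (U l - U m)| := by rw [abs_mul, abs_sub_comm]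
    _ ≤ |l - m| * (‖U m‖ * ‖U l - U m‖) := by gcongr; exact abs_real_inner_le_norm _ _
    _ = _ := by ring

lemma mul_norm_sub_le (h : EnergyRelation U V) {l m : ℝ} (hl : 0 ≤ l) (hm : 0 ≤ m) :
    l * ‖U l - U m‖ ≤ |l - m| * ‖U m‖ := by
  have h1 := h.diff_energy hl hm
  rcases (norm_nonneg (U l - U m)).eq_or_lt with h0 | h0
  · rw [← h0]; simp; positivity
  · refine le_of_mul_le_mul_right ?_ h0
    nlinarith [sq_nonneg ‖V l - V m‖]

/-- The factor `l` lets the estimate reach the endpoint `0`, where `mul_norm_sub_le` only bounds `U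
l - U 0`. -/
lemma continuousOn_smul (h : EnergyRelation U V) : ContinuousOn (fun l => l • U l) (Ici 0) := by
  intro m hm
  rw [ContinuousWithinAt, tendsto_iff_norm_sub_tendsto_zero]
  have hlim : Tendsto (fun l : ℝ => 2 * (|l - m| * ‖U m‖)) (𝓝[Ici 0] m) (𝓝 0) := by
    have : Continuous (fun l : ℝ => 2 * (|l - m| * ‖U m‖)) := by fun_prop
    simpa using (this.tendsto m).mono_left nhdsWithin_le_nhds
  refine squeeze_zero' (Eventually.of_forall fun _ => norm_nonneg _) ?_ hlim
  filter_upwards [self_mem_nhdsWithin] with l hl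
  have e : l • U l - m • U m = l • (U l - U m) + (l - m) • U m := by
    rw [smul_sub, sub_smul]; abel
  have h1 := h.mul_norm_sub_le hl hm
  calc _ ≤ ‖l • (U l - U m)‖ + ‖(l - m) • U m‖ := by rw [e]; exact norm_add_le _ _
    _ = l * ‖U l - U m‖ + |l - m| * ‖U m‖ := by
      rw [norm_smul, norm_smul, Real.norm_of_nonneg hl, Real.norm_eq_abs]
    _ ≤ _ := by linarith

lemma continuousOn_snd (h : EnergyRelation U V) : ContinuousOn V (Ici 0) := by
  intro m hm
  rw [ContinuousWithinAt, tendsto_iff_norm_sub_tendsto_zero]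
  have hlim : Tendsto (fun l : ℝ => √(|l - m| * ‖U m‖ * ‖U m‖)) (𝓝[Ici 0] m) (𝓝 0) := by
    have : Continuous (fun l : ℝ => √(|l - m| * ‖U m‖ * ‖U m‖)) := by fun_prop
    simpa using (this.tendsto m).mono_left nhdsWithin_le_nhds
  refine squeeze_zero' (Eventually.of_forall fun _ => norm_nonneg _) ?_ hlim
  -- This lets `mul_norm_sub_le` absorb the factor `‖U l - U m‖`, also at `m = 0`.
  have hev : ∀ᶠ l in 𝓝[Ici 0] m, |l - m| ≤ l := by
    rcases (show 0 ≤ m from hm).eq_or_lt with rfl | h0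
    · filter_upwards [self_mem_nhdsWithin] with l hl
      simp [abs_of_nonneg (show (0 : ℝ) ≤ l from hl)]
    · filter_upwards [mem_nhdsWithin_of_mem_nhds (lt_mem_nhds (show m / 2 < m by linarith))]
        with l hl
      exact abs_le.2 ⟨by linarith, by linarith⟩
  filter_upwards [self_mem_nhdsWithin, hev] with l hl hlm
  refine Real.le_sqrt_of_sq_le ?_
  have h1 := h.diff_energy hl hm
  have h2 := h.mul_norm_sub_le hl hm
  have h3 : 0 ≤ l * ‖U l - U m‖ ^ 2 := mul_nonneg hl (sq_nonneg _)
  calc ‖V l - V m‖ ^ 2 ≤ |l - m| * ‖U l - U m‖ * ‖U m‖ := by linarith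
    _ ≤ l * ‖U l - U m‖ * ‖U m‖ := by gcongr
    _ ≤ _ := by gcongr

lemma exists_le (h : EnergyRelation U V) {p q : ℕ → ℝ} (hp : Tendsto p atTop (𝓝 0))
    (hp0 : ∀ n, 0 ≤ p n) (hq0 : ∀ n, 0 ≤ q n)
    (hpq : ∀ l, 0 ≤ l → ∀ n, 1 ≤ ‖V l‖ * p n + ‖U l‖ * q n) {d : ℝ} (hd : 0 < d) :
    ∃ l, 0 < l ∧ ‖V l‖ ≤ d * l * ‖U l‖ := by
  by_contra! hcon
  set G : ℝ → ℝ := fun l => ‖V l‖ ^ 2 + l * ‖U l‖ ^ 2 with hG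
  -- Minimality at `2l` gives `G (2l) ≤ G l + l‖U l‖²`, and the negated claim makes the last term at
  -- most `‖V l‖² / (d² l)`. The factors at `l = 2^n` have a convergent product.
  have hstep : ∀ l, 0 < l → G (2 * l) ≤ G l * Real.exp (1 / (d ^ 2 * l)) := by
    intro l hl
    have h1 := h.energy_le hl.le (show 0 ≤ 2 * l by linarith)
    have h2 : (d * l * ‖U l‖) ^ 2 ≤ ‖V l‖ ^ 2 := by gcongr; exact (hcon l hl).le
    have h3 : l * ‖U l‖ ^ 2 ≤ ‖V l‖ ^ 2 * (1 / (d ^ 2 * l)) := by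
      rw [mul_one_div, le_div_iff₀ (by positivity)]; linarith
    have h4 : 0 ≤ l * ‖U l‖ ^ 2 * (1 / (d ^ 2 * l)) := by positivity
    calc G (2 * l) ≤ G l * (1 / (d ^ 2 * l) + 1) := by simp only [hG]; linarith
      _ ≤ _ := by
        refine mul_le_mul_of_nonneg_left (Real.add_one_le_exp _) ?_
        change 0 ≤ ‖V l‖ ^ 2 + l * ‖U l‖ ^ 2
        positivity
  have hbd : ∀ n : ℕ, G (2 ^ n) ≤ G 1 * Real.exp ((2 - 2 * (1 / 2) ^ n) / d ^ 2) := by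
    intro n
    induction n with
    | zero => simp
    | succ n ih =>
      rw [pow_succ']
      refine (hstep _ (by positivity)).trans ?_
      calc _ ≤ G 1 * Real.exp ((2 - 2 * (1 / 2) ^ n) / d ^ 2)
              * Real.exp (1 / (d ^ 2 * 2 ^ n)) := by gcongr
        _ = _ := by
          rw [mul_assoc, ← Real.exp_add]
          congr 2
          simp only [pow_succ, one_div_pow]
          field_simp
          ring
  set C := G 1 * Real.exp (2 / d ^ 2) with hC
  have hG1 : 0 ≤ G 1 := by simp only [hG]; positivity
  have hbd' : ∀ n : ℕ, G (2 ^ n) ≤ C := fun n => (hbd n).trans (by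
    rw [hC]; gcongr
    have : (0 : ℝ) ≤ 2 * (1 / 2) ^ n := by positivity
    linarith)
  -- Bounded energy forces `U (2^n) → 0` while `‖V (2^n)‖ ≤ √C`; here `N` is fixed and `n → ∞`. Then
  -- `N → ∞` gives `1 ≤ 0`.
  have key : ∀ N, 1 ≤ √C * p N := by
    intro N
    have hle : ∀ n : ℕ, 1 ≤ √C * p N + √(C * (1 / 2) ^ n) * q N := by
      intro n
      have hb := hbd' n
      simp only [hG] at hb
      have h2 : (0 : ℝ) < 2 ^ n := by positivity
      refine (hpq (2 ^ n) h2.le N).trans ?_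
      gcongr
      · exact hp0 N
      · exact Real.le_sqrt_of_sq_le (by nlinarith [sq_nonneg ‖U (2 ^ n)‖])
      · exact hq0 N
      · refine Real.le_sqrt_of_sq_le ?_
        rw [one_div_pow, mul_one_div, le_div_iff₀ h2]
        nlinarith [sq_nonneg ‖V (2 ^ n)‖]
    have hlim : Tendsto (fun n : ℕ => √C * p N + √(C * (1 / 2) ^ n) * q N) atTop
        (𝓝 (√C * p N + √(C * 0) * q N)) := by
      refine tendsto_const_nhds.add (Tendsto.mul_const _ ?_)
      exact (Real.continuous_sqrt.tendsto _).comp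
        ((tendsto_pow_atTop_nhds_zero_of_lt_one (by norm_num) (by norm_num)).const_mul C)
    simpa using ge_of_tendsto' hlim hle
  have := ge_of_tendsto' (hp.const_mul √C) key
  norm_num at this

lemma exists_eq (h : EnergyRelation U V) (h0 : V 0 ≠ 0) {p q : ℕ → ℝ}
    (hp : Tendsto p atTop (𝓝 0)) (hp0 : ∀ n, 0 ≤ p n) (hq0 : ∀ n, 0 ≤ q n)
    (hpq : ∀ l, 0 ≤ l → ∀ n, 1 ≤ ‖V l‖ * p n + ‖U l‖ * q n) {d : ℝ} (hd : 0 < d) :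
    ∃ l, 0 < l ∧ d * l * ‖U l‖ = ‖V l‖ := by
  obtain ⟨L, hL, hL'⟩ := h.exists_le hp hp0 hq0 hpq hd
  have hc : ContinuousOn (fun l => d * ‖l • U l‖ - ‖V l‖) (Icc 0 L) :=
    ((continuousOn_const.mul h.continuousOn_smul.norm).sub h.continuousOn_snd.norm).mono
      Icc_subset_Ici_self
  have hz : (0 : ℝ) ∈ Icc (d * ‖(0 : ℝ) • U 0‖ - ‖V 0‖) (d * ‖L • U L‖ - ‖V L‖) := by
    constructor
    · simp
    · rw [norm_smul, Real.norm_of_nonneg hL.le]; linarith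
  obtain ⟨l, hl, hl0⟩ := intermediate_value_Icc hL.le hc hz
  simp only at hl0
  rcases hl.1.eq_or_lt with rfl | hpos
  · simp [h0] at hl0
  · refine ⟨l, hpos, ?_⟩
    rw [norm_smul, Real.norm_of_nonneg hpos.le] at hl0
    linarith

lemma eq_of_eq (h : EnergyRelation U V) (hU : ∀ l, 0 ≤ l → U l ≠ 0)
    (hprop : ∀ l m a b : ℝ, 0 ≤ l → 0 ≤ m → a • U l = b • U m → a = b) {d l m : ℝ} (hd : 0 < d)
    (hl : 0 < l) (hm : 0 < m) (el : d * l * ‖U l‖ = ‖V l‖)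
    (em : d * m * ‖U m‖ = ‖V m‖) : l = m := by
  have a0 : 0 < ‖U l‖ := norm_pos_iff.2 (hU l hl.le)
  have b0 : 0 < ‖U m‖ := norm_pos_iff.2 (hU m hm.le)
  have h1 := h l m hl.le hm.le
  have h2 := h m l hm.le hl.le
  rw [real_inner_comm, real_inner_comm (U l)] at h2
  have hV := real_inner_le_norm (V l) (V m)
  have hU' := real_inner_le_norm (U l) (U m)
  rw [← em] at h1 hV
  rw [← el] at h2 hV
  set a := ‖U l‖
  set b := ‖U m‖
  set P := inner ℝ (V l) (V m)
  set Q := inner ℝ (U l) (U m)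
  -- Cauchy–Schwarz in both inner products, with `‖V‖` eliminated by the two equations; together
  -- with `k2` it forces equality, so `U l` and `U m` are positively proportional.
  have k1 : (d ^ 2 * m + 1) * b ≤ (d ^ 2 * l + 1) * a := by
    refine le_of_mul_le_mul_right ?_ (mul_pos hm b0)
    nlinarith [mul_le_mul_of_nonneg_left hU' hm.le]
  have k2 : (d ^ 2 * l + 1) * a ≤ (d ^ 2 * m + 1) * b := by
    refine le_of_mul_le_mul_right ?_ (mul_pos hl a0)
    nlinarith [mul_le_mul_of_nonneg_left hU' hl.le]
  have k3 := le_antisymm k2 k1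
  have hQ : Q = a * b := by
    refine le_antisymm hU' (le_of_mul_le_mul_left ?_ hm)
    nlinarith [congrArg (fun t => t * (m * b)) k3]
  have hs : b • U l = a • U m := by
    rw [← sub_eq_zero, ← norm_eq_zero, ← sq_eq_zero_iff, norm_sub_sq_real, norm_smul, norm_smul,
      real_inner_smul_left, real_inner_smul_right, Real.norm_of_nonneg b0.le,
      Real.norm_of_nonneg a0.le]
    change (b * a) ^ 2 - 2 * (b * (a * Q)) + (a * b) ^ 2 = 0
    rw [hQ]; ring
  have hab := hprop l m b a hl.le hm.le hs
  rw [hab] at k3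
  have k4 := mul_right_cancel₀ a0.ne' k3
  have hd2 : 0 < d ^ 2 := by positivity
  exact mul_left_cancel₀ hd2.ne' (by linarith)

end EnergyRelation

end Abstract

/-! ### One-sided derivatives on the interval and integration by parts -/

section Derivatives

lemma uniqueDiffOn_I : UniqueDiffOn ℝ I := uniqueDiffOn_Icc (by norm_num)

lemma D_zero (f : ℝ → ℝ) : D 0 f = f := iteratedDerivWithin_zero

lemma D_succ (n : ℕ) (f : ℝ → ℝ) : D (n + 1) f = derivWithin (D n f) I :=
  iteratedDerivWithin_succ

lemma D_D (m n : ℕ) (f : ℝ → ℝ) : D m (D n f) = D (m + n) f := by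
  induction m with
  | zero => rw [D_zero, zero_add]
  | succ m ih => rw [D_succ, ih, Nat.succ_add, D_succ]

lemma D_const_mul (n : ℕ) (c : ℝ) (f : ℝ → ℝ) (x : ℝ) :
    D n (fun z => c * f z) x = c * D n f x :=
  iteratedDerivWithin_const_mul_field c f

lemma D_zero_fun (n : ℕ) (x : ℝ) : D n (fun _ => 0) x = 0 :=
  iteratedDerivWithin_fun_const_zero

lemma D_congr (n : ℕ) {f g : ℝ → ℝ} (h : EqOn f g I) : EqOn (D n f) (D n g) I :=
  iteratedDerivWithin_congr h

lemma _root_.ContDiffOn.D {f : ℝ → ℝ} {m : ℕ} (n : ℕ) (hf : ContDiffOn ℝ (m + n : ℕ) f I) :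
    ContDiffOn ℝ m (LandauKolmogorov.D n f) I := by
  induction n generalizing m with
  | zero => simpa [D_zero] using hf
  | succ n ih =>
    rw [D_succ]
    refine ContDiffOn.derivWithin (n := (m + 1 : ℕ)) (ih ?_) uniqueDiffOn_I (by norm_cast)
    rwa [add_assoc, add_comm 1 n]

lemma absCont_of_contDiffOn {f : ℝ → ℝ} (hf : ContDiffOn ℝ 1 f I) :
    AbsolutelyContinuousOnInterval f (-1) 1 := by
  apply ContDiffOn.absolutelyContinuousOnInterval
  rwa [uIcc_of_le (by norm_num)]

instance : IsFiniteMeasure μI := ⟨by simp [μI, I]⟩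

lemma memLp_of_continuousOn {f : ℝ → ℝ} (hf : ContinuousOn f I) : MemLp f 2 μI := by
  obtain ⟨C, hC⟩ := isCompact_Icc.exists_bound_of_continuousOn hf
  exact MemLp.of_bound (hf.aestronglyMeasurable measurableSet_Icc) C
    ((ae_restrict_iff' measurableSet_Icc).2 (.of_forall hC))

lemma integral_μI (f : ℝ → ℝ) : ∫ x, f x ∂μI = ∫ x in (-1 : ℝ)..1, f x := by
  rw [intervalIntegral.integral_of_le (by norm_num), μI, I, integral_Icc_eq_integral_Ioc]

lemma memL2r_of_contDiffOn {r : ℕ} (hr : 0 < r) {f : ℝ → ℝ} (hf : ContDiffOn ℝ r f I) :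
    MemL2r r f := by
  refine ⟨hf.of_le (by exact_mod_cast Nat.sub_le _ _), absCont_of_contDiffOn ?_,
    memLp_of_continuousOn ?_⟩
  · have := ContDiffOn.D (m := 1) (r - 1) (f := f) (by rwa [Nat.add_sub_cancel' hr])
    simpa using this
  · exact (ContDiffOn.D (m := 0) r (f := f) (by simpa using hf)).continuousOn

lemma MemL2r.const_mul {r : ℕ} {f : ℝ → ℝ} (hf : MemL2r r f) (c : ℝ) :
    MemL2r r (fun x => c * f x) := by
  have e : ∀ n, D n (fun x => c * f x) = fun x => c * D n f x :=
    fun n => funext fun x => D_const_mul n c f x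
  refine ⟨contDiffOn_const.mul hf.contDiffOn, ?_, ?_⟩
  · rw [e]; exact hf.absCont.const_mul c
  · rw [e]; exact hf.memLp.const_mul c

lemma MemL2r.contDiffOn_of_lt {r m : ℕ} {f : ℝ → ℝ} (hf : MemL2r r f) (h : m < r) :
    ContDiffOn ℝ m f I :=
  hf.contDiffOn.of_le (by exact_mod_cast Nat.le_sub_one_of_lt h)

lemma MemL2r.of_two_mul {r : ℕ} (hr : 0 < r) {f : ℝ → ℝ} (hf : MemL2r (2 * r) f) :
    MemL2r r f :=
  memL2r_of_contDiffOn hr (hf.contDiffOn_of_lt (by omega))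

/-- The `r`-th derivative of a solution serves as a test function and, rescaled, as the extremal
function. -/
lemma MemL2r.D_of_two_mul {r : ℕ} (hr : 0 < r) {f : ℝ → ℝ} (hf : MemL2r (2 * r) f) :
    MemL2r r (D r f) := by
  refine ⟨ContDiffOn.D r ((hf.contDiffOn_of_lt (by omega))), ?_, ?_⟩
  · rw [D_D, show r - 1 + r = 2 * r - 1 by omega]; exact hf.absCont
  · rw [D_D, ← two_mul]; exact hf.memLp

lemma MemL2r.absCont_of_lt {r j : ℕ} {f : ℝ → ℝ} (hf : MemL2r r f) (hj : j < r) :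
    AbsolutelyContinuousOnInterval (D j f) (-1) 1 := by
  rcases (Nat.le_sub_one_of_lt hj).eq_or_lt with rfl | h
  · exact hf.absCont
  · exact absCont_of_contDiffOn
      (by simpa using ContDiffOn.D (m := 1) j (hf.contDiffOn_of_lt (by omega)))

lemma MemL2r.continuousOn_D {r j : ℕ} {f : ℝ → ℝ} (hf : MemL2r r f) (hj : j < r) :
    ContinuousOn (D j f) I := by
  have := (hf.absCont_of_lt hj).continuousOn
  rwa [uIcc_of_le (by norm_num)] at this

lemma MemL2r.memLp_D {r j : ℕ} {f : ℝ → ℝ} (hf : MemL2r r f) (hj : j ≤ r) :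
    MemLp (D j f) 2 μI := by
  rcases hj.eq_or_lt with rfl | h
  · exact hf.memLp
  · exact memLp_of_continuousOn (hf.continuousOn_D h)

lemma MemL2r.memLp_self {r : ℕ} (hr : 0 < r) {f : ℝ → ℝ} (hf : MemL2r r f) : MemLp f 2 μI := by
  simpa [D_zero] using hf.memLp_D hr.le

lemma integral_derivWithin_mul {F G : ℝ → ℝ} (hF : AbsolutelyContinuousOnInterval F (-1) 1)
    (hG : AbsolutelyContinuousOnInterval G (-1) 1) :
    ∫ x in (-1 : ℝ)..1, derivWithin F I x * G x =
      F 1 * G 1 - F (-1) * G (-1) - ∫ x in (-1 : ℝ)..1, F x * derivWithin G I x := by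
  have key : ∀ K : ℝ → ℝ, ∀ᵐ x : ℝ, x ∈ uIoc (-1 : ℝ) 1 → derivWithin K I x = deriv K x := by
    intro K
    -- At the endpoint `1` the two-sided derivative sees values outside the interval.
    filter_upwards [Measure.ae_ne volume (1 : ℝ)] with x hx hx'
    rw [uIoc_of_le (by norm_num)] at hx'
    exact derivWithin_of_mem_nhds (Icc_mem_nhds hx'.1 (lt_of_le_of_ne hx'.2 hx))
  have h1 : ∫ x in (-1 : ℝ)..1, derivWithin F I x * G x = ∫ x in (-1 : ℝ)..1, deriv F x * G x :=
    intervalIntegral.integral_congr_ae ((key F).mono fun x h hx => by simp only [h hx])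
  have h2 : ∫ x in (-1 : ℝ)..1, F x * derivWithin G I x = ∫ x in (-1 : ℝ)..1, F x * deriv G x :=
    intervalIntegral.integral_congr_ae ((key G).mono fun x h hx => by simp only [h hx])
  rw [h1, h2, hF.integral_mul_deriv_eq_deriv_mul hG]
  ring

/-- Repeated integration by parts. -/
lemma integral_D_mul {r : ℕ} {w f : ℝ → ℝ} (hw : MemL2r r w) (hf : MemL2r r f) {n : ℕ}
    (hn : n ≤ r) :
    ∫ x, D n w x * D (r - n) f x ∂μI =
      ∑ s ∈ Finset.range n, (-1 : ℝ) ^ (n - 1 - s) *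
        (D s w 1 * D (r - 1 - s) f 1 - D s w (-1) * D (r - 1 - s) f (-1)) +
      (-1) ^ n * ∫ x, w x * D r f x ∂μI := by
  induction n with
  | zero => simp [D_zero]
  | succ n ih =>
    have ih := ih (by omega)
    have h1 := integral_derivWithin_mul (hw.absCont_of_lt (show n < r by omega))
      (hf.absCont_of_lt (show r - 1 - n < r by omega))
    rw [← D_succ, ← D_succ, show r - 1 - n + 1 = r - n by omega, ← integral_μI,
      ← integral_μI, ih] at h1
    rw [show r - (n + 1) = r - 1 - n by omega, h1, Finset.sum_range_succ]
    have h2 : ∀ s ∈ Finset.range n, (-1 : ℝ) ^ (n + 1 - 1 - s) *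
        (D s w 1 * D (r - 1 - s) f 1 - D s w (-1) * D (r - 1 - s) f (-1)) =
        -((-1 : ℝ) ^ (n - 1 - s) *
        (D s w 1 * D (r - 1 - s) f 1 - D s w (-1) * D (r - 1 - s) f (-1))) := by
      intro s hs
      rw [Finset.mem_range] at hs
      rw [show n + 1 - 1 - s = n - 1 - s + 1 by omega, pow_succ]
      ring
    rw [Finset.sum_congr rfl h2, Finset.sum_neg_distrib]
    simp only [Nat.add_sub_cancel, Nat.sub_self, pow_zero, one_mul, pow_succ]
    ring

end Derivatives

/-! ### Passage to classes in `L₂` -/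

section L2

open Classical in
/-- The class in `L₂` of a square integrable function (and `0` for other functions). -/
noncomputable def toL2 (f : ℝ → ℝ) : L2 := if h : MemLp f 2 μI then h.toLp else 0

lemma coeFn_toL2 {f : ℝ → ℝ} (hf : MemLp f 2 μI) : toL2 f =ᵐ[μI] f := by
  rw [toL2, dif_pos hf]; exact hf.coeFn_toLp

lemma norm_toL2 {f : ℝ → ℝ} (hf : MemLp f 2 μI) : ‖toL2 f‖ = norm2 f := by
  rw [toL2, dif_pos hf, Lp.norm_toLp, norm2]

lemma inner_toL2 {f g : ℝ → ℝ} (hf : MemLp f 2 μI) (hg : MemLp g 2 μI) :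
    inner ℝ (toL2 f) (toL2 g) = ∫ x, f x * g x ∂μI := by
  rw [L2.inner_def]
  refine integral_congr_ae ?_
  filter_upwards [coeFn_toL2 hf, coeFn_toL2 hg] with x h1 h2
  simp [h1, h2, mul_comm]

lemma toL2_congr {f g : ℝ → ℝ} (hf : MemLp f 2 μI) (hg : MemLp g 2 μI) (h : f =ᵐ[μI] g) :
    toL2 f = toL2 g :=
  Lp.ext ((coeFn_toL2 hf).trans (h.trans (coeFn_toL2 hg).symm))

lemma toL2_const_mul {f : ℝ → ℝ} (hf : MemLp f 2 μI) (c : ℝ) :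
    toL2 (fun x => c * f x) = c • toL2 f := by
  apply Lp.ext
  filter_upwards [coeFn_toL2 (hf.const_mul c), coeFn_toL2 hf, Lp.coeFn_smul c (toL2 f)]
    with x h1 h2 h3
  rw [h1, h3, Pi.smul_apply, h2, smul_eq_mul]

lemma norm_toL2_sub {f : ℝ → ℝ} (hf : MemLp f 2 μI) (y : L2) :
    ‖toL2 f - y‖ = norm2 (fun x => f x - y x) := by
  rw [norm2, Lp.norm_def]
  congr 1
  refine eLpNorm_congr_ae ?_
  filter_upwards [Lp.coeFn_sub (toL2 f) y, coeFn_toL2 hf] with x h1 h2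
  rw [h1, Pi.sub_apply, h2]

lemma eqOn_of_toL2_eq {f g : ℝ → ℝ} (hf : ContinuousOn f I) (hg : ContinuousOn g I)
    (h : toL2 f = toL2 g) : EqOn f g I := by
  refine Measure.eqOn_Icc_of_ae_eq (μ := volume) (by norm_num) ?_ hf hg
  have h1 := coeFn_toL2 (memLp_of_continuousOn hf)
  have h2 := coeFn_toL2 (memLp_of_continuousOn hg)
  rw [h] at h1
  exact h1.symm.trans h2

end L2

/-! ### Boundary terms and uniqueness for the differential equation -/

section Boundary

/-- Repeated integration by parts in terms of inner products in `L₂`. -/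
lemma inner_sub_inner {r : ℕ} (hr : 0 < r) {w f : ℝ → ℝ} (hw : MemL2r r w) (hf : MemL2r r f) :
    inner ℝ (toL2 (D r w)) (toL2 f) - (-1) ^ r * inner ℝ (toL2 w) (toL2 (D r f)) =
      ∑ s ∈ Finset.range r, (-1 : ℝ) ^ (r - 1 - s) *
        (D s w 1 * D (r - 1 - s) f 1 - D s w (-1) * D (r - 1 - s) f (-1)) := by
  rw [inner_toL2 hw.memLp (hf.memLp_self hr), inner_toL2 (hw.memLp_self hr) hf.memLp]
  have := integral_D_mul hw hf le_rfl
  rw [Nat.sub_self, D_zero] at this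
  rw [this]; ring

/-- Functions in `L₂^{2r}` satisfying the differential equation almost everywhere. -/
structure SolvesAE (r : ℕ) (lam : ℝ) (u : ℝ → ℝ) : Prop where
  memL2r : MemL2r (2 * r) u
  eqn : D (2 * r) u =ᵐ[μI] fun x => -(-1) ^ r * lam * u x

lemma IsSolution.solvesAE {r k : ℕ} {lam : ℝ} {u : ℝ → ℝ} (h : IsSolution r k lam u) :
    SolvesAE r lam u := by
  refine ⟨h.memL2r, ?_⟩
  rw [Filter.EventuallyEq, μI, I, ← restrict_Ioo_eq_restrict_Icc,
    ae_restrict_iff' measurableSet_Ioo]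
  refine .of_forall fun x hx => ?_
  have h1 := h.eqn x hx
  have h2 : ((-1 : ℝ) ^ r) * (-1) ^ r = 1 := by rw [← mul_pow]; norm_num
  linear_combination (-1) ^ r * h1 - D (2 * r) u x * h2

lemma SolvesAE.toL2_D_D {r : ℕ} (hr : 0 < r) {lam : ℝ} {u : ℝ → ℝ} (h : SolvesAE r lam u) :
    toL2 (D r (D r u)) = (-(-1) ^ r * lam) • toL2 u := by
  have hu := (h.memL2r.of_two_mul hr).memLp_self hr
  rw [← toL2_const_mul hu, D_D, ← two_mul]
  exact toL2_congr h.memL2r.memLp (hu.const_mul _) h.eqn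

/-- Weak form of the equation: the right side sees `w` only through its boundary derivatives of
order below `r`. -/
lemma SolvesAE.inner_add_inner {r : ℕ} (hr : 0 < r) {lam : ℝ} {u w : ℝ → ℝ}
    (h : SolvesAE r lam u) (hw : MemL2r r w) :
    inner ℝ (toL2 (D r w)) (toL2 (D r u)) + lam * inner ℝ (toL2 w) (toL2 u) =
      ∑ s ∈ Finset.range r, (-1 : ℝ) ^ (r - 1 - s) *
        (D s w 1 * D (r - 1 - s) (D r u) 1 - D s w (-1) * D (r - 1 - s) (D r u) (-1)) := by
  rw [← inner_sub_inner hr hw (h.memL2r.D_of_two_mul hr), h.toL2_D_D hr, real_inner_smul_right]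
  have h2 : ((-1 : ℝ) ^ r) * (-1) ^ r = 1 := by rw [← mul_pow]; norm_num
  linear_combination -lam * inner ℝ (toL2 w) (toL2 u) * h2

/-- The base point is arbitrary because uniqueness integrates from `-1`, while nonvanishing of
`u^{(r)}` integrates from `1`. -/
lemma eqOn_of_D_eqOn {r : ℕ} {u v : ℝ → ℝ} {a : ℝ} (ha : a ∈ I) (hu : ContDiffOn ℝ r u I) (hv : ContDiffOn ℝ r v I)
    (hD : EqOn (D r u) (D r v) I) (hl : ∀ s < r, D s u a = D s v a) : EqOn u v I := by
  induction r with
  | zero => simpa [D_zero] using hD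
  | succ r ih =>
    refine ih (hu.of_le (by exact_mod_cast r.le_succ)) (hv.of_le (by exact_mod_cast r.le_succ))
      ?_ fun s hs => hl s (by omega)
    have d : ∀ {g : ℝ → ℝ}, ContDiffOn ℝ (r + 1 : ℕ) g I → DifferentiableOn ℝ (D r g) I :=
      fun hg => (ContDiffOn.D (m := 1) r (by rwa [add_comm 1 r])).differentiableOn (by simp)
    have hc := constant_of_derivWithin_zero ((d hu).sub (d hv)) (fun x hx => by
      have hx' := Ico_subset_Icc_self hx
      change derivWithin (D r u - D r v) I x = 0
      rw [derivWithin_sub (d hu x hx') (d hv x hx')]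
      have := hD hx'
      rw [D_succ, D_succ] at this
      exact sub_eq_zero.2 this)
    intro x hx
    have := (hc x hx).trans (hc a ha).symm
    simp only [Pi.sub_apply, hl r r.lt_succ_self, sub_self] at this
    exact sub_eq_zero.1 this

/-- The difference has zero boundary data, hence zero energy `‖D^r(u - v)‖² + λ‖u - v‖²`. Only the
first term is used, so `λ = 0` is covered. -/
lemma SolvesAE.eqOn {r : ℕ} (hr : 0 < r) {lam : ℝ} (hlam : 0 ≤ lam) {u v : ℝ → ℝ}
    (hu : SolvesAE r lam u) (hv : SolvesAE r lam v)
    (hl : ∀ s < r, D s u (-1) = D s v (-1)) (hR : ∀ s < r, D s u 1 = D s v 1) :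
    EqOn u v I := by
  have cu := hu.memL2r.contDiffOn_of_lt (show r < 2 * r by omega)
  have cv := hv.memL2r.contDiffOn_of_lt (show r < 2 * r by omega)
  refine eqOn_of_D_eqOn ⟨le_rfl, by norm_num⟩ cu cv ?_ hl
  refine eqOn_of_toL2_eq (hu.memL2r.continuousOn_D (by omega))
    (hv.memL2r.continuousOn_D (by omega)) ?_
  have key : ∀ {z : ℝ → ℝ}, SolvesAE r lam z →
      inner ℝ (toL2 (D r u)) (toL2 (D r z)) + lam * inner ℝ (toL2 u) (toL2 z) =
      inner ℝ (toL2 (D r v)) (toL2 (D r z)) + lam * inner ℝ (toL2 v) (toL2 z) := by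
    intro z hz
    rw [hz.inner_add_inner hr (hu.memL2r.of_two_mul hr),
      hz.inner_add_inner hr (hv.memL2r.of_two_mul hr)]
    refine Finset.sum_congr rfl fun s hs => ?_
    rw [Finset.mem_range] at hs
    rw [hl s hs, hR s hs]
  have h1 := key hu
  have h2 := key hv
  rw [real_inner_self_eq_norm_sq, real_inner_self_eq_norm_sq,
    real_inner_comm (toL2 (D r u)), real_inner_comm (toL2 u)] at h1
  rw [real_inner_self_eq_norm_sq, real_inner_self_eq_norm_sq] at h2
  have h3 := norm_sub_sq_real (toL2 (D r u)) (toL2 (D r v))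
  have h4 := norm_sub_sq_real (toL2 u) (toL2 v)
  have h5 : 0 ≤ lam * ‖toL2 u - toL2 v‖ ^ 2 := by positivity
  rw [h4] at h5
  have h6 : ‖toL2 (D r u) - toL2 (D r v)‖ ^ 2 ≤ 0 := by rw [h3]; linarith
  rw [← sub_eq_zero, ← norm_eq_zero]
  exact pow_eq_zero_iff two_ne_zero |>.1 (le_antisymm h6 (sq_nonneg _))

/-- The boundary conditions turn the boundary terms into `f^{(k)}(-1)`. -/
lemma IsSolution.D_neg_one {r k : ℕ} (hk : k < r) {lam : ℝ} {u f : ℝ → ℝ}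
    (hu : IsSolution r k lam u) (hf : MemL2r r f) :
    inner ℝ (toL2 (D r u)) (toL2 f) - (-1) ^ r * inner ℝ (toL2 u) (toL2 (D r f)) =
      D k f (-1) := by
  have hr : 0 < r := by omega
  rw [inner_sub_inner hr (hu.memL2r.of_two_mul hr) hf,
    Finset.sum_eq_single_of_mem (r - k - 1) (Finset.mem_range.2 (by omega))]
  · rw [hu.left _ (by omega), hu.right _ (by omega), if_pos rfl,
      show r - 1 - (r - k - 1) = k by omega, pow_succ]
    -- The signs are `(-1)^k` from the parts formula, `-1` from the lower limit and `(-1)^(k+1)`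
    -- from the boundary condition.
    have h2 : ((-1 : ℝ) ^ k) * (-1) ^ k = 1 := by rw [← mul_pow]; norm_num
    linear_combination D k f (-1) * h2
  · intro s hs hne
    rw [Finset.mem_range] at hs
    rw [hu.left s hs, hu.right s hs, if_neg hne]
    ring

end Boundary

/-! ### Solvability of the boundary value problem -/

section Existence

/-- The companion map of the equation `u^{(n)} = c u`. -/
noncomputable def companion (n : ℕ) (c : ℝ) : (Fin n → ℝ) →L[ℝ] (Fin n → ℝ) :=
  LinearMap.toContinuousLinearMap
    { toFun := fun v i => if h : (i : ℕ) + 1 < n then v ⟨i + 1, h⟩ else c * v ⟨0, i.pos⟩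
      map_add' := fun v w => by ext i; simp only [Pi.add_apply]; split_ifs <;> ring
      map_smul' := fun a v => by
        ext i; simp only [Pi.smul_apply, smul_eq_mul, RingHom.id_apply]; split_ifs <;> ring }

lemma companion_apply (n : ℕ) (c : ℝ) (v : Fin n → ℝ) (i : Fin n) :
    companion n c v i = if h : (i : ℕ) + 1 < n then v ⟨i + 1, h⟩ else c * v ⟨0, i.pos⟩ := rfl

/-- The flow of the companion map, equal to the identity at `-1`. -/
noncomputable def flow (n : ℕ) (c x : ℝ) : (Fin n → ℝ) →L[ℝ] (Fin n → ℝ) :=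
  NormedSpace.exp ((x + 1) • companion n c)

lemma flow_neg_one (n : ℕ) (c : ℝ) (v : Fin n → ℝ) : flow n c (-1) v = v := by
  simp [flow]

lemma hasDerivAt_flow (n : ℕ) (c x : ℝ) (v : Fin n → ℝ) :
    HasDerivAt (fun x => flow n c x v) (companion n c (flow n c x v)) x := by
  have h := (hasDerivAt_exp_smul_const' (companion n c) (x + 1)).comp_add_const x 1
  have h' := h.clm_apply (hasDerivAt_const x v)
  rw [map_zero, add_zero] at h'
  exact h'

lemma contDiff_flow (n : ℕ) (c : ℝ) (v : Fin n → ℝ) (m : ℕ) :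
    ContDiff ℝ m (fun x => flow n c x v) := by
  induction m with
  | zero =>
    rw [Nat.cast_zero]
    exact contDiff_zero.2
      (continuous_iff_continuousAt.2 fun x => (hasDerivAt_flow n c x v).continuousAt)
  | succ m ih =>
    rw [Nat.cast_succ, contDiff_succ_iff_deriv]
    refine ⟨fun x => (hasDerivAt_flow n c x v).differentiableAt, by simp, ?_⟩
    rw [show deriv (fun x => flow n c x v) = fun x => companion n c (flow n c x v) from
      funext fun x => (hasDerivAt_flow n c x v).deriv]
    exact (companion n c).contDiff.comp ih

lemma derivWithin_flow (n : ℕ) (c : ℝ) (v : Fin n → ℝ) (i : Fin n) {x : ℝ} (hx : x ∈ I) :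
    derivWithin (fun x => flow n c x v i) I x = companion n c (flow n c x v) i :=
  ((hasDerivAt_pi.1 (hasDerivAt_flow n c x v)) i).hasDerivWithinAt.derivWithin
    (uniqueDiffOn_I x hx)

lemma D_flow {n : ℕ} (c : ℝ) (v : Fin n → ℝ) {j : ℕ} (hj : j < n) :
    EqOn (D j fun x => flow n c x v ⟨0, by omega⟩) (fun x => flow n c x v ⟨j, hj⟩) I := by
  induction j with
  | zero => rw [D_zero]; exact fun _ _ => rfl
  | succ j ih =>
    intro x hx
    rw [D_succ, derivWithin_congr (ih (by omega)) (ih (by omega) hx), derivWithin_flow _ _ _ _ hx,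
      companion_apply, dif_pos hj]

lemma D_flow_self {n : ℕ} (hn : 0 < n) (c : ℝ) (v : Fin n → ℝ) {x : ℝ} (hx : x ∈ I) :
    D n (fun x => flow n c x v ⟨0, hn⟩) x = c * flow n c x v ⟨0, hn⟩ := by
  obtain ⟨m, rfl⟩ := Nat.exists_eq_succ_of_ne_zero hn.ne'
  have h := D_flow c v m.lt_succ_self
  rw [D_succ, derivWithin_congr h (h hx), derivWithin_flow _ _ _ _ hx, companion_apply,
    dif_neg (by simp)]

lemma memL2r_flow {n : ℕ} (hn : 0 < n) (c : ℝ) (v : Fin n → ℝ) :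
    MemL2r n (fun x => flow n c x v ⟨0, hn⟩) :=
  memL2r_of_contDiffOn hn (contDiff_pi.1 (contDiff_flow n c v n) _).contDiffOn

lemma solvesAE_flow {r : ℕ} (hr : 0 < 2 * r) (lam : ℝ) (v : Fin (2 * r) → ℝ) :
    SolvesAE r lam (fun x => flow (2 * r) (-(-1) ^ r * lam) x v ⟨0, hr⟩) :=
  ⟨memL2r_flow hr _ v, (ae_restrict_iff' measurableSet_Icc).2
    (.of_forall fun _ hx => D_flow_self hr _ v hx)⟩

lemma solvesAE_zero {r : ℕ} (hr : 0 < r) (lam : ℝ) : SolvesAE r lam (fun _ => 0) := by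
  refine ⟨memL2r_of_contDiffOn (by omega) contDiffOn_const, .of_forall fun x => ?_⟩
  simp [D_zero_fun]

/-- The boundary values at `-1` and `1` of the solution with given initial data. -/
noncomputable def boundaryValues (r : ℕ) (c : ℝ) :
    (Fin (2 * r) → ℝ) →ₗ[ℝ] (Fin r → ℝ) × (Fin r → ℝ) where
  toFun v := (fun s => v ⟨s, by omega⟩, fun s => flow (2 * r) c 1 v ⟨s, by omega⟩)
  map_add' v w := by simp only [map_add]; rfl
  map_smul' a v := by simp only [map_smul]; rfl

/-- Both spaces have dimension `2r`, so the energy uniqueness, which gives injectivity, suffices. -/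
lemma boundaryValues_surjective {r : ℕ} (hr : 0 < r) {lam : ℝ} (hlam : 0 ≤ lam) :
    Function.Surjective (boundaryValues r (-(-1) ^ r * lam)) := by
  set c := -(-1) ^ r * lam
  refine (LinearMap.injective_iff_surjective_of_finrank_eq_finrank
    (by simp [two_mul])).1 ((injective_iff_map_eq_zero _).2 fun v hv => ?_)
  have hm : (-1 : ℝ) ∈ I := ⟨le_rfl, by norm_num⟩
  have h1 : (1 : ℝ) ∈ I := ⟨by norm_num, le_rfl⟩
  have e := (solvesAE_flow (by omega) lam v).eqOn hr hlam (solvesAE_zero hr lam)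
    (fun s hs => by
      rw [D_flow _ v (show s < 2 * r by omega) hm, D_zero_fun]
      simp only [flow_neg_one]
      exact congrFun (congrArg Prod.fst hv) ⟨s, hs⟩)
    (fun s hs => by
      rw [D_flow _ v (show s < 2 * r by omega) h1, D_zero_fun]
      exact congrFun (congrArg Prod.snd hv) ⟨s, hs⟩)
  ext i
  have := D_congr i e hm
  rw [D_flow _ v i.2 hm, D_zero_fun] at this
  simp only [flow_neg_one] at this
  exact this

lemma exists_isSolution {r k : ℕ} (hk : k < r) {lam : ℝ} (hlam : 0 ≤ lam) :
    ∃ u, IsSolution r k lam u := by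
  have hr : 0 < r := by omega
  obtain ⟨v, hv⟩ := boundaryValues_surjective hr hlam
    (fun s => if (s : ℕ) = r - k - 1 then (-1 : ℝ) ^ (k + 1) else 0, fun _ => 0)
  have h2 : ((-1 : ℝ) ^ r) * (-1) ^ r = 1 := by rw [← mul_pow]; norm_num
  refine ⟨_, memL2r_flow (by omega) (-(-1) ^ r * lam) v, fun x hx => ?_, fun s hs => ?_,
    fun s hs => ?_⟩
  · rw [D_flow_self (by omega) _ v (Ioo_subset_Icc_self hx)]
    set y := flow (2 * r) (-(-1) ^ r * lam) x v ⟨0, by omega⟩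
    linear_combination -lam * y * h2
  · rw [D_flow _ v (show s < 2 * r by omega) ⟨le_rfl, by norm_num⟩]
    simp only [flow_neg_one]
    exact congrFun (congrArg Prod.fst hv) ⟨s, hs⟩
  · rw [D_flow _ v (show s < 2 * r by omega) ⟨by norm_num, le_rfl⟩]
    exact congrFun (congrArg Prod.snd hv) ⟨s, hs⟩

lemma IsSolution.eqOn {r k : ℕ} (hk : k < r) {lam : ℝ} (hlam : 0 ≤ lam) {u v : ℝ → ℝ}
    (hu : IsSolution r k lam u) (hv : IsSolution r k lam v) : EqOn u v I :=
  hu.solvesAE.eqOn (by omega) hlam hv.solvesAE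
    (fun s hs => by rw [hu.left s hs, hv.left s hs])
    (fun s hs => by rw [hu.right s hs, hv.right s hs])

end Existence

/-! ### The solutions as a family in the parameter -/

section Family

open Filter Topology

variable {r k : ℕ} {u : ℝ → ℝ → ℝ}

lemma IsSolution.memL2r_self (hk : k < r) {lam : ℝ} {u : ℝ → ℝ} (hu : IsSolution r k lam u) :
    MemL2r r u := hu.memL2r.of_two_mul (by omega)

/-- Test functions which are small in `L₂` while their derivatives at `-1` stay away from `0`. -/
noncomputable def expTest (n : ℕ) (x : ℝ) : ℝ := Real.exp (-(n + 1) * (x + 1))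

lemma D_expTest (n j : ℕ) {x : ℝ} (hx : x ∈ I) :
    D j (expTest n) x = (-(n + 1)) ^ j * expTest n x := by
  induction j generalizing x with
  | zero => simp [D_zero]
  | succ j ih =>
    rw [D_succ, derivWithin_congr (fun y hy => ih hy) (ih hx)]
    have h : HasDerivAt (fun y : ℝ => -((n : ℝ) + 1) * (y + 1)) (-((n : ℝ) + 1) * 1) x :=
      ((hasDerivAt_id x).add_const 1).const_mul _
    have h' := (h.exp.const_mul ((-((n : ℝ) + 1)) ^ j)).hasDerivWithinAt (s := I)
    refine (h'.derivWithin (uniqueDiffOn_I x hx)).trans ?_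
    rw [expTest, pow_succ]; ring

lemma memL2r_expTest (hr : 0 < r) (n : ℕ) : MemL2r r (expTest n) :=
  memL2r_of_contDiffOn hr (by unfold expTest; fun_prop)

lemma norm2_expTest_sq (n : ℕ) : norm2 (expTest n) ^ 2 ≤ 1 / (n + 1) := by
  have hm := (memL2r_expTest Nat.one_pos n).memLp_self Nat.one_pos
  rw [← norm_toL2 hm, ← real_inner_self_eq_norm_sq, inner_toL2 hm hm, integral_μI]
  have hd : ∀ x ∈ uIcc (-1 : ℝ) 1, HasDerivAt
      (fun y => -(1 / (2 * (n + 1))) * Real.exp (-(2 * (n + 1)) * (y + 1)))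
      (expTest n x * expTest n x) x := by
    intro x _
    have h : HasDerivAt (fun y : ℝ => -(2 * ((n : ℝ) + 1)) * (y + 1))
        (-(2 * ((n : ℝ) + 1)) * 1) x := ((hasDerivAt_id x).add_const 1).const_mul _
    have h' := h.exp.const_mul (-(1 / (2 * ((n : ℝ) + 1))))
    refine h'.congr_deriv ?_
    unfold expTest
    rw [← Real.exp_add, show -((n : ℝ) + 1) * (x + 1) + -((n : ℝ) + 1) * (x + 1) =
      -(2 * ((n : ℝ) + 1)) * (x + 1) by ring]
    field_simp
  rw [intervalIntegral.integral_eq_sub_of_hasDerivAt hd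
    (Continuous.intervalIntegrable (by unfold expTest; fun_prop) _ _)]
  have h1 : (0 : ℝ) < 1 / (2 * (n + 1)) := by positivity
  have h2 : (1 : ℝ) / (n + 1) = 2 * (1 / (2 * (n + 1))) := by field_simp
  have h3 := mul_pos h1 (Real.exp_pos (-(2 * (n + 1)) * ((1 : ℝ) + 1)))
  rw [h2, neg_add_cancel, mul_zero, Real.exp_zero]
  linarith

lemma tendsto_norm2_expTest : Tendsto (fun n => norm2 (expTest n)) atTop (𝓝 0) := by
  refine squeeze_zero (fun n => ENNReal.toReal_nonneg)
    (fun n => Real.le_sqrt_of_sq_le (norm2_expTest_sq n)) ?_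
  have h := (Real.continuous_sqrt.tendsto 0).comp tendsto_one_div_add_atTop_nhds_zero_nat
  rwa [Real.sqrt_zero] at h

lemma one_le_abs_D_expTest (n j : ℕ) : 1 ≤ |D j (expTest n) (-1)| := by
  rw [D_expTest n j ⟨le_rfl, by norm_num⟩]
  simp only [expTest, neg_add_cancel, mul_zero, Real.exp_zero, mul_one, abs_pow, abs_neg]
  refine one_le_pow₀ ?_
  rw [abs_of_pos (by positivity)]
  linarith [n.cast_nonneg (α := ℝ)]

lemma IsSolution.abs_D_neg_one_sub_le (hk : k < r) {lam : ℝ} {u f : ℝ → ℝ}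
    (hu : IsSolution r k lam u) (hf : MemL2r r f) (y : L2) :
    |D k f (-1) - inner ℝ (toL2 (D r u)) y| ≤
      ‖toL2 (D r u)‖ * ‖toL2 f - y‖ + ‖toL2 u‖ * ‖toL2 (D r f)‖ := by
  rw [← hu.D_neg_one hk hf]
  have e : inner ℝ (toL2 (D r u)) (toL2 f) - (-1) ^ r * inner ℝ (toL2 u) (toL2 (D r f)) -
      inner ℝ (toL2 (D r u)) y = inner ℝ (toL2 (D r u)) (toL2 f - y) -
      (-1) ^ r * inner ℝ (toL2 u) (toL2 (D r f)) := by rw [inner_sub_right]; ring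
  rw [e]
  refine (abs_sub _ _).trans (add_le_add (abs_real_inner_le_norm _ _) ?_)
  rw [abs_mul, abs_neg_one_pow, one_mul]
  exact abs_real_inner_le_norm _ _

/-- The right side does not involve `w` or its parameter `mu`; this independence is the energy
relation. -/
lemma SolvesAE.inner_eq {lam : ℝ} (hk : k < r) (hr : 0 < r) {w v : ℝ → ℝ} {mu : ℝ}
    (hw : IsSolution r k mu w) (hv : SolvesAE r lam v) :
    inner ℝ (toL2 (D r w)) (toL2 (D r v)) + lam * inner ℝ (toL2 w) (toL2 v) =
      D k (D r v) (-1) := by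
  rw [hv.inner_add_inner hr (hw.memL2r_self hk), ← hw.D_neg_one hk (hv.memL2r.D_of_two_mul hr),
    inner_sub_inner hr (hw.memL2r_self hk) (hv.memL2r.D_of_two_mul hr)]

lemma energyRelation (hk : k < r) (hu : ∀ l, 0 ≤ l → IsSolution r k l (u l)) :
    EnergyRelation (fun l => toL2 (u l)) (fun l => toL2 (D r (u l))) := by
  intro l m hl hm
  have h := fun l hl => SolvesAE.inner_eq hk (by omega) (hu l hl) (hu m hm).solvesAE
  rw [h l hl, ← h m hm, real_inner_self_eq_norm_sq, real_inner_self_eq_norm_sq]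

lemma IsSolution.continuousOn (hk : k < r) {lam : ℝ} {u : ℝ → ℝ} (hu : IsSolution r k lam u) :
    ContinuousOn u I := by
  simpa [D_zero] using (hu.memL2r_self hk).continuousOn_D (show 0 < r by omega)

/-- The derivative of order `r - k - 1` at `-1` has the same nonzero value for all parameters. -/
lemma eq_of_smul_toL2_eq (hk : k < r) {l m a b : ℝ} {u v : ℝ → ℝ} (hu : IsSolution r k l u)
    (hv : IsSolution r k m v) (h : a • toL2 u = b • toL2 v) : a = b := by
  have hr : 0 < r := by omega
  rw [← toL2_const_mul ((hu.memL2r_self hk).memLp_self hr),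
    ← toL2_const_mul ((hv.memL2r_self hk).memLp_self hr)] at h
  have e := D_congr (r - k - 1) (f := fun x => a * u x) (g := fun x => b * v x)
    (eqOn_of_toL2_eq (continuousOn_const.mul (hu.continuousOn hk))
    (continuousOn_const.mul (hv.continuousOn hk)) h) (x := -1) ⟨le_rfl, by norm_num⟩
  rw [D_const_mul, D_const_mul, hu.left _ (by omega), hv.left _ (by omega), if_pos rfl] at e
  exact mul_right_cancel₀ (pow_ne_zero _ (by norm_num)) e

lemma IsSolution.toL2_ne_zero (hk : k < r) {l : ℝ} {u : ℝ → ℝ} (hu : IsSolution r k l u) :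
    toL2 u ≠ 0 := fun h => by
  have := eq_of_smul_toL2_eq hk hu hu (a := 0) (b := 1) (by simp [h])
  norm_num at this

lemma IsSolution.toL2_D_ne_zero (hk : k < r) {l : ℝ} {u : ℝ → ℝ}
    (hu : IsSolution r k l u) : toL2 (D r u) ≠ 0 := by
  intro h
  have h0 : toL2 (fun _ => 0) = 0 := by
    simpa using toL2_const_mul (memLp_of_continuousOn (hu.continuousOn hk)) 0
  have hD0 : D r (fun _ => 0) = fun _ => 0 := funext fun x => D_zero_fun r x
  refine hu.toL2_ne_zero hk ?_
  rw [← h0]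
  refine toL2_congr (memLp_of_continuousOn (hu.continuousOn hk))
    (memLp_of_continuousOn continuousOn_const)
    ((ae_restrict_iff' measurableSet_Icc).2 (.of_forall ?_))
  refine eqOn_of_D_eqOn (r := r) (a := 1) ⟨by norm_num, le_rfl⟩
    (hu.memL2r.contDiffOn_of_lt (by omega)) contDiffOn_const ?_ fun s hs => ?_
  · rw [hD0]
    exact eqOn_of_toL2_eq (hu.memL2r.continuousOn_D (by omega)) continuousOn_const (h.trans h0.symm)
  · rw [hu.right s hs, D_zero_fun]

lemma exists_parameter (hk : k < r) (hu : ∀ l, 0 ≤ l → IsSolution r k l (u l)) {d : ℝ}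
    (hd : 0 < d) : ∃ l, 0 < l ∧ d * l * ‖toL2 (u l)‖ = ‖toL2 (D r (u l))‖ := by
  have hr : 0 < r := by omega
  have hm := fun n => memL2r_expTest hr n
  refine (energyRelation hk hu).exists_eq ((hu 0 le_rfl).toL2_D_ne_zero hk)
    tendsto_norm2_expTest (fun n => ENNReal.toReal_nonneg)
    (q := fun n => norm2 (D r (expTest n))) (fun n => ENNReal.toReal_nonneg) ?_ hd
  intro l hl n
  have h := (hu l hl).abs_D_neg_one_sub_le hk (hm n) 0
  rw [inner_zero_right, sub_zero, sub_zero, norm_toL2 ((hm n).memLp_self hr),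
    norm_toL2 (hm n).memLp] at h
  exact (one_le_abs_D_expTest n k).trans h

end Family

/-! ### Upper and lower bounds for optimal recovery -/

section Recovery

variable {r k : ℕ}

/-- The number `S 0` must approximate both `f^{(k)}(t)` and its negative, so one of the two errors
is at least `|f^{(k)}(t)|`. -/
lemma modulus_le_methodError (t δ : ℝ) (S : L2 → ℝ) :
    modulus r k t δ ≤ methodError r k t δ S := by
  refine iSup_le fun f => iSup_le fun hf => iSup_le fun hδ => ?_
  have h1 : ∀ g : ℝ → ℝ, g ∈ W r → norm2 g ≤ δ →
      ENNReal.ofReal |D k g t - S 0| ≤ methodError r k t δ S := by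
    intro g hg hgδ
    refine le_iSup_of_le g (le_iSup_of_le hg (le_iSup_of_le 0 (le_iSup_of_le ?_ le_rfl)))
    have h0 : (fun x => g x - (0 : L2) x) =ᵐ[μI] g := by
      filter_upwards [Lp.coeFn_zero ℝ 2 μI] with x hx
      rw [hx, Pi.zero_apply, sub_zero]
    rwa [norm2, eLpNorm_congr_ae h0]
  have hn : ∀ g : ℝ → ℝ, norm2 (fun x => -1 * g x) = norm2 g := fun g => by
    rw [norm2, norm2, ← eLpNorm_neg g]
    congr 2; ext x; simp
  have hneg : (fun x => -1 * f x) ∈ W r := ⟨hf.1.const_mul _, by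
    rw [show D r (fun x => -1 * f x) = fun x => -1 * D r f x from
      funext fun x => D_const_mul _ _ _ _, hn]
    exact hf.2⟩
  have a1 := h1 f hf hδ
  have a2 := h1 _ hneg ((hn f).le.trans hδ)
  rw [D_const_mul] at a2
  have : |D k f t| ≤ max |D k f t - S 0| |-1 * D k f t - S 0| := by
    rcases le_total 0 (D k f t) with h | h <;> rcases le_total 0 (S 0) with h' | h'
    · refine le_max_of_le_right ?_
      rw [abs_of_nonneg h, abs_of_nonpos (by linarith)]; linarith
    · refine le_max_of_le_left ?_
      rw [abs_of_nonneg h, abs_of_nonneg (by linarith)]; linarith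
    · refine le_max_of_le_left ?_
      rw [abs_of_nonpos h, abs_of_nonpos (by linarith)]; linarith
    · refine le_max_of_le_right ?_
      rw [abs_of_nonpos h, abs_of_nonneg (by linarith)]; linarith
  refine (ENNReal.ofReal_le_ofReal this).trans ?_
  rw [ENNReal.ofReal_max]
  exact max_le a1 a2

lemma IsSolution.methodError_le (hk : k < r) {l δ : ℝ} {u : ℝ → ℝ} (hu : IsSolution r k l u) :
    methodError r k (-1) δ (fun y => inner ℝ (toL2 (D r u)) y) ≤
      ENNReal.ofReal (‖toL2 (D r u)‖ * δ + ‖toL2 u‖) := by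
  refine iSup_le fun f => iSup_le fun hf => iSup_le fun y => iSup_le fun hy => ?_
  refine ENNReal.ofReal_le_ofReal ((hu.abs_D_neg_one_sub_le hk hf.1 y).trans ?_)
  rw [norm_toL2_sub (hf.1.memLp_self (by omega)), norm_toL2 hf.1.memLp]
  refine add_le_add (by gcongr) ?_
  exact mul_le_of_le_one_right (norm_nonneg _) hf.2

lemma IsSolution.le_modulus (hk : k < r) {l δ : ℝ} {u : ℝ → ℝ} (hl : 0 < l)
    (hu : IsSolution r k l u) (he : δ * l * ‖toL2 u‖ = ‖toL2 (D r u)‖) :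
    ENNReal.ofReal (‖toL2 (D r u)‖ * δ + ‖toL2 u‖) ≤ modulus r k (-1) δ := by
  have hr : 0 < r := by omega
  have ha : 0 < ‖toL2 u‖ := norm_pos_iff.2 (hu.toL2_ne_zero hk)
  have hm := hu.memL2r.D_of_two_mul hr
  -- Since `‖u^{(2r)}‖ = l‖u‖`, this normalizes the `r`-th derivative of `c u^{(r)}` to norm `1`; by
  -- `he` its own norm is then `δ`.
  set c : ℝ := 1 / (l * ‖toL2 u‖) with hc
  have hc0 : 0 < c := by positivity
  have hf := hm.const_mul c
  have e : D r (fun x => c * D r u x) = fun x => c * D r (D r u) x :=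
    funext fun x => D_const_mul _ _ _ _
  refine le_iSup_of_le (fun x => c * D r u x) (le_iSup_of_le ⟨hf, ?_⟩ (le_iSup_of_le ?_ ?_))
  · rw [← norm_toL2 hf.memLp, e, toL2_const_mul hm.memLp, hu.solvesAE.toL2_D_D hr, norm_smul,
      norm_smul, Real.norm_of_nonneg hc0.le, norm_mul, norm_neg, norm_pow, norm_neg, norm_one,
      one_pow, one_mul, Real.norm_of_nonneg hl.le, hc, one_div_mul_cancel (by positivity)]
  · rw [← norm_toL2 (hf.memLp_self hr), toL2_const_mul (hm.memLp_self hr), norm_smul,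
      Real.norm_of_nonneg hc0.le, ← he, hc]
    apply le_of_eq; field_simp
  · refine ENNReal.ofReal_le_ofReal (le_trans (le_of_eq ?_) (le_abs_self _))
    rw [D_const_mul, ← SolvesAE.inner_eq hk hr hu hu.solvesAE, real_inner_self_eq_norm_sq,
      real_inner_self_eq_norm_sq, ← he, hc]
    field_simp

end Recovery

end LandauKolmogorov

open LandauKolmogorov in
theorem mainTheorem1 (r k : ℕ) (hk : k < r) :
    ∃ u : ℝ → ℝ → ℝ,
      (∀ lam : ℝ, 0 ≤ lam →
        IsSolution r k lam (u lam) ∧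
          ∀ v : ℝ → ℝ, IsSolution r k lam v → Set.EqOn v (u lam) (Set.Icc (-1) 1)) ∧
      ∀ δ : ℝ, 0 < δ →
        ∃ lam : ℝ,
          (0 < lam ∧ δ * lam * norm2 (u lam) = norm2 (D r (u lam))) ∧
          (∀ lam' : ℝ, 0 < lam' → δ * lam' * norm2 (u lam') = norm2 (D r (u lam')) →
            lam' = lam) ∧
          modulus r k (-1) δ = ENNReal.ofReal (norm2 (D r (u lam)) * δ + norm2 (u lam)) ∧
          optimalError allMethods r k (-1) δ =
            ENNReal.ofReal (norm2 (D r (u lam)) * δ + norm2 (u lam)) ∧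
          optimalError linearMethods r k (-1) δ =
            ENNReal.ofReal (norm2 (D r (u lam)) * δ + norm2 (u lam)) := by
  have hr : 0 < r := by omega
  -- Negative parameters receive the zero function, so that a total family can be chosen.
  have hex : ∀ l : ℝ, ∃ u, 0 ≤ l → IsSolution r k l u := fun l => by
    by_cases hl : 0 ≤ l
    · obtain ⟨u, hu⟩ := exists_isSolution hk hl
      exact ⟨u, fun _ => hu⟩
    · exact ⟨fun _ => 0, fun h => absurd h hl⟩
  choose u hu using hex
  have n1 : ∀ l, 0 ≤ l → norm2 (u l) = ‖toL2 (u l)‖ := fun l hl =>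
    (norm_toL2 (((hu l hl).memL2r_self hk).memLp_self hr)).symm
  have n2 : ∀ l, 0 ≤ l → norm2 (D r (u l)) = ‖toL2 (D r (u l))‖ := fun l hl =>
    (norm_toL2 ((hu l hl).memL2r_self hk).memLp).symm
  refine ⟨u, fun l hl => ⟨hu l hl, fun v hv => hv.eqOn hk hl (hu l hl)⟩, fun δ hδ => ?_⟩
  obtain ⟨l, hl, he⟩ := exists_parameter hk hu hδ
  have hlow := (hu l hl.le).le_modulus hk hl he
  have hup := (hu l hl.le).methodError_le hk (δ := δ)
  have hlin : (fun y : L2 => inner ℝ (toL2 (D r (u l))) y) ∈ linearMethods :=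
    ⟨fun x y => inner_add_right _ x y, fun c x => real_inner_smul_right _ x c⟩
  have hbelow : ∀ R, modulus r k (-1) δ ≤ optimalError R r k (-1) δ := fun R =>
    le_iInf fun S => le_iInf fun _ => modulus_le_methodError _ _ S
  have habove : ∀ R : Set (L2 → ℝ), (fun y : L2 => inner ℝ (toL2 (D r (u l))) y) ∈ R →
      optimalError R r k (-1) δ ≤ ENNReal.ofReal (‖toL2 (D r (u l))‖ * δ + ‖toL2 (u l)‖) :=
    fun R hR => (iInf₂_le _ hR).trans hup
  refine ⟨l, ?_⟩
  rw [n1 l hl.le, n2 l hl.le]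
  refine ⟨⟨hl, he⟩, fun l' hl' he' => ?_, ?_, ?_, ?_⟩
  · rw [n1 l' hl'.le, n2 l' hl'.le] at he'
    exact (energyRelation hk hu).eq_of_eq (fun m hm => (hu m hm).toL2_ne_zero hk)
      (fun m n a b hm hn => eq_of_smul_toL2_eq hk (hu m hm) (hu n hn)) hδ hl' hl he' he
  · exact le_antisymm ((modulus_le_methodError _ _ _).trans hup) hlow
  · exact le_antisymm (habove _ (Set.mem_univ _)) (hlow.trans (hbelow _))
  · exact le_antisymm (habove _ hlin) (hlow.trans (hbelow _))
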